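/- Let $n>1$, $0<s<n$ be integers, let $C\in\mathbb{R}^{n\times n}$ be symmetric positive semidefinite with $\operatorname{rank}(C)\ge s$, and let $A\in\mathbb{R}^{m\times n}$, $b\in\mathbb{R}^m$. Write $\operatorname{ldet}$ for the natural logarithm of the determinant (equal to $-\infty$ for a singular positive semidefinite matrix) and $\mathbf{e}$ for the all-ones vector; a maximum over the empty set is $-\infty$. The constrained maximum-entropy sampling problem is $$z(C,s,A,b):=\max\{\operatorname{ldet} C[S(x),S(x)] : \mathbf{e}^\top x=s,\ x\in\{0,1\}^n,\ Ax\le b\},$$ where $S(x)$ is the support of $x$ and $C[S,S]$ is the principal submatrix of $C$ indexed by $S$. For $\Upsilon=(\gamma_1,\dots,\gamma_n)^\top\in\mathbb{R}^n_{++}$ put $F(x;\Upsilon):=\operatorname{Diag}(\Upsilon)\,C\operatorname{Diag}(x)\,C\operatorname{Diag}(\Upsilon)+\operatorname{Diag}(\mathbf{e}-x)$, $\operatorname{dom}(f;\Upsilon):=\{x\in\mathbb{R}^n: F(x;\Upsilon)\succ 0\}$, $$f(x;\Upsilon):=\tfrac12\operatorname{ldet}F(x;\Upsilon)-\sum_{i=1}^n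 x_i\log\gamma_i\quad (x\in\operatorname{dom}(f;\Upsilon)),\qquad f(x;\Upsilon):=-\infty\ \text{ otherwise},$$ and let $z_{\rm linx}(\Upsilon):=\max\{f(x;\Upsilon): \mathbf{e}^\top x=s,\ 0\le x\le\mathbf{e},\ Ax\le b\}$. Both maxima are attained whenever the respective feasible set is nonempty, and the following hold. (i) For all $\Upsilon\in\mathbb{R}^n_{++}$, $z(C,s,A,b)\le z_{\rm linx}(\Upsilon)$. (ii) For all $\Upsilon\in\mathbb{R}^n_{++}$, $f(\cdot;\Upsilon)$ is concave on the convex set $\operatorname{dom}(f;\Upsilon)$; and $f$ is continuously differentiable in $(x,\Upsilon)$ on the open set $\{(x,\Upsilon):\Upsilon\in\mathbb{R}^n_{++},\ x\in\operatorname{dom}(f;\Upsilon)\}$. (iii) If $x\in[0,1]^n$ lies in $\operatorname{dom}(f;\Upsilon)$ for some $\Upsilon\in\mathbb{R}^n_{++}$, then it does so for every $\Upsilon\in\mathbb{R}^n_{++}$, and $f(x;\Upsilon)$ is convex in $\log\Upsilon$, i.e. $u\mapsto f(x;(e^{u_1},\dots,e^{u_n}))$ is convex on $\mathbb{R}^n$.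 Also $z_{\rm linx}(\Upsilon)$ is convex in $\log\Upsilon$: for all $u,v\in\mathbb{R}^n$ and $t,r\ge 0$ with $t+r=1$, $$z_{\rm linx}(e^{tu+rv})\le t\,z_{\rm linx}(e^{u})+r\,z_{\rm linx}(e^{v})$$ (componentwise exponentials; values in $[-\infty,\infty)$, with $0\cdot(-\infty)=0$). -/

import Mathlib

open scoped Matrix

noncomputable section

namespace Linx

/-- The extended-real log-determinant: `log det M` if `det M > 0`, and `-∞` otherwise
(for a positive semidefinite `M`, the latter is exactly the case `det M = 0`). -/
def ldet {ι : Type*} [Fintype ι] [DecidableEq ι] (M : Matrix ι ι ℝ) : EReal :=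
  if 0 < M.det then ((Real.log M.det : ℝ) : EReal) else ⊥

variable {n m : ℕ}

/-- The support `S(x)`. -/
def supp (x : Fin n → ℝ) : Finset (Fin n) := Finset.univ.filter (fun i => x i ≠ 0)

/-- The principal submatrix `C[S,S]`. -/
def principal (C : Matrix (Fin n) (Fin n) ℝ) (S : Finset (Fin n)) : Matrix S S ℝ :=
  C.submatrix Subtype.val Subtype.val

/-- The feasible set of CMESP: `eᵀx = s`, `x ∈ {0,1}ⁿ`, `Ax ≤ b`. -/
def cmespFeasible (s : ℕ) (A : Matrix (Fin m) (Fin n) ℝ) (b : Fin m → ℝ) :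
    Set (Fin n → ℝ) :=
  {x | ∑ i, x i = s ∧ (∀ i, x i = 0 ∨ x i = 1) ∧ A *ᵥ x ≤ b}

/-- The objective of CMESP, `ldet C[S(x),S(x)]`. -/
def cmespObj (C : Matrix (Fin n) (Fin n) ℝ) (x : Fin n → ℝ) : EReal :=
  ldet (principal C (supp x))

/-- The optimal value `z(C,s,A,b)` of CMESP (`-∞` if the problem is infeasible). -/
def zCmesp (C : Matrix (Fin n) (Fin n) ℝ) (s : ℕ) (A : Matrix (Fin m) (Fin n) ℝ)
    (b : Fin m → ℝ) : EReal :=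
  sSup (cmespObj C '' cmespFeasible s A b)

/-- `Diag(Υ) C Diag(x) C Diag(Υ) + Diag(e - x)`. -/
def linxMatrix (C : Matrix (Fin n) (Fin n) ℝ) (Υ x : Fin n → ℝ) : Matrix (Fin n) (Fin n) ℝ :=
  Matrix.diagonal Υ * C * Matrix.diagonal x * C * Matrix.diagonal Υ
    + Matrix.diagonal (fun i => 1 - x i)

/-- The domain `dom(f_linx; Υ)`: the points of `ℝⁿ` at which the matrix is positive definite. -/
def linxDom (C : Matrix (Fin n) (Fin n) ℝ) (Υ : Fin n → ℝ) : Set (Fin n → ℝ) :=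
  {x | (linxMatrix C Υ x).PosDef}

/-- The function `f_linx(x; Υ)`, meaningful for `Υ > 0` and `x ∈ dom(f_linx; Υ)`. -/
def fLinx (C : Matrix (Fin n) (Fin n) ℝ) (x Υ : Fin n → ℝ) : ℝ :=
  1 / 2 * Real.log (linxMatrix C Υ x).det - ∑ i, x i * Real.log (Υ i)

open Classical in
/-- `f_linx(·; Υ)` as an objective function, with value `-∞` outside its domain. -/
def linxObj (C : Matrix (Fin n) (Fin n) ℝ) (Υ x : Fin n → ℝ) : EReal :=
  if x ∈ linxDom C Υ then ((fLinx C x Υ : ℝ) : EReal) else ⊥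

/-- The feasible set of the linx relaxation: `eᵀx = s`, `0 ≤ x ≤ e`, `Ax ≤ b`. -/
def linxFeasible (s : ℕ) (A : Matrix (Fin m) (Fin n) ℝ) (b : Fin m → ℝ) :
    Set (Fin n → ℝ) :=
  {x | ∑ i, x i = s ∧ (∀ i, 0 ≤ x i ∧ x i ≤ 1) ∧ A *ᵥ x ≤ b}

/-- The g-scaled linx bound `z_linx(Υ)` (`-∞` if the relaxation is infeasible). -/
def zLinx (C : Matrix (Fin n) (Fin n) ℝ) (s : ℕ) (A : Matrix (Fin m) (Fin n) ℝ)
    (b : Fin m → ℝ) (Υ : Fin n → ℝ) : EReal :=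
  sSup (linxObj C Υ '' linxFeasible s A b)

end Linx

end

/-!
Everything rests on three facts about the matrix
`F(x; Υ) = Diag(Υ) C Diag(x) C Diag(Υ) + Diag(e - x)` and its determinant.

* **Expansion along the diagonal part.** Multilinearity of the determinant in the rows gives
  `det (M + Diag(d)) = ∑_S det M[S,S] ∏_{i ∉ S} dᵢ` (`det_add_diagonal`). For `x` in the unit box,
  `det F(x; Υ)` is therefore a polynomial in the `γᵢ²` whose coefficients do not depend on `Υ` and
  are products of principal minors of a positive semidefinite matrix with numbers `1 - xᵢ ≥ 0`
  (`det_linxMatrix_eq_sum`, `linxCoeff_nonneg`). Positive definiteness of `F` means that one of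
  these coefficients is positive, a condition without `Υ`; and in the variables `log γᵢ` the
  determinant is a posynomial, hence log-convex (`log_sum_exp_convex`). This is the convexity of `f`
  in `log Υ`, and it passes to the optimal value because the domain is the same for all scalings.

* **Factorization at binary points.** If `x` is the indicator of `S`, then `F = Gᵀ G`, where `G` has
  the rows of `C Diag(Υ)` on `S` and those of the identity elsewhere. Hence
  `det F = (det C[S,S] ∏_{i ∈ S} γᵢ)²`, so that `f(x; Υ) = ldet C[S,S]`: the relaxation is exact at
  binary points, which makes it an upper bound (`cmespObj_le_linxObj`).

* **Concavity of `log det`.** The inequality `log λ ≤ λ - 1`, summed over eigenvalues and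
  transported by a congruence, is the tangent-plane inequality for `log det` on positive definite
  matrices, and averaging it gives concavity (`log_det_concave`). Since `F` is affine in `x`, `f` is
  concave in `x`.

The maximum of the relaxation is attained because `exp (2 f)` extends continuously by zero to the
whole compact feasible set (`isGreatest_zLinx`); the combinatorial problem is finite. The joint
domain is open because positive definiteness can be tested on the compact unit sphere
(`isOpen_setOf_posDef`).
-/

namespace Linx

open Matrix

/-! ### Positive definite matrices and their determinants -/

/-- Positive definite matrices form a convex set. -/
lemma posDef_combination {ι : Type*} {X Y : Matrix ι ι ℝ} (hX : X.PosDef) (hY : Y.PosDef) {a b : ℝ}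
    (ha : 0 ≤ a) (hb : 0 ≤ b) (hab : a + b = 1) : (a • X + b • Y).PosDef := by
  rcases ha.eq_or_lt with rfl | ha'
  · obtain rfl : b = 1 := by linarith
    simpa using hY
  · exact (hX.smul ha').add_posSemidef (hY.posSemidef.smul hb)

/-- Along a continuous family of Hermitian matrices, positive definiteness is an open condition:
it only has to be tested on the compact unit sphere. -/
lemma isOpen_setOf_posDef {ι T : Type*} [Fintype ι] [TopologicalSpace T] {F : T → Matrix ι ι ℝ}
    (hF : Continuous F) (hH : ∀ p, (F p).IsHermitian) : IsOpen {p | (F p).PosDef} := by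
  have hiff : ∀ p, (F p).PosDef ↔ ∀ v ∈ Metric.sphere (0 : ι → ℝ) 1, 0 < v ⬝ᵥ (F p *ᵥ v) := by
    intro p
    constructor
    · intro h v hv
      have hv0 : v ≠ 0 := by
        rintro rfl
        simp at hv
      simpa using h.dotProduct_mulVec_pos hv0
    · intro h
      refine .of_dotProduct_mulVec_pos (hH p) fun v hv => ?_
      have hn : 0 < ‖v‖ := norm_pos_iff.2 hv
      have hw := h (‖v‖⁻¹ • v) (by simp [norm_smul, hn.ne'])
      simp only [mulVec_smul, smul_dotProduct, dotProduct_smul, smul_eq_mul] at hw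
      have hi : 0 < ‖v‖⁻¹ := inv_pos.2 hn
      rw [mul_pos_iff_of_pos_left hi, mul_pos_iff_of_pos_left hi] at hw
      simpa using hw
  simp_rw [hiff, isOpen_iff_eventually]
  intro p hp
  refine (isCompact_sphere (0 : ι → ℝ) 1).eventually_forall_of_forall_eventually
    (P := fun p v => 0 < v ⬝ᵥ (F p *ᵥ v)) fun v hv => ?_
  have hc : Continuous fun z : T × (ι → ℝ) => z.2 ⬝ᵥ (F z.1 *ᵥ z.2) := by fun_prop
  exact hc.continuousAt.eventually (lt_mem_nhds (hp v hv))

section General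

variable {ι : Type*} [Fintype ι] [DecidableEq ι]

/-- Replacing the rows outside `S` by those of a diagonal matrix leaves a block triangular matrix,
whose determinant only sees the principal block on `S`. -/
lemma det_piecewise_diagonal {R : Type*} [CommRing R] (M : Matrix ι ι R) (d : ι → R)
    (S : Finset ι) :
    (of (S.piecewise M (diagonal d))).det =
      (M.submatrix (Subtype.val : S → ι) Subtype.val).det * ∏ i ∈ Sᶜ, d i := by
  rw [twoBlockTriangular_det _ (fun i => i ∈ S)]
  · have h₁ : (toSquareBlockProp (of (S.piecewise M (diagonal d))) fun i => i ∈ S) =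
        M.submatrix (Subtype.val : S → ι) Subtype.val := by
      ext i j
      simp [toSquareBlockProp, toBlock, Finset.piecewise]
    have h₂ : (toSquareBlockProp (of (S.piecewise M (diagonal d))) fun i => i ∉ S) =
        diagonal (fun i : {i // i ∉ S} => d i) := by
      ext i j
      simp [toSquareBlockProp, toBlock, Finset.piecewise, i.2, diagonal_apply, Subtype.ext_iff]
    rw [h₁, h₂, det_diagonal]
    congr 1
    · congr!
    · exact (Finset.prod_subtype Sᶜ (p := fun i => i ∉ S) (by simp) d).symm
  · intro i hi j hj
    have hij : i ≠ j := by rintro rfl; exact hi hj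
    simp [Finset.piecewise, hi, hij]

/-- The determinant of `M + Diag(d)` as a polynomial in `d`, with the principal minors of `M` as
coefficients. -/
lemma det_add_diagonal {R : Type*} [CommRing R] (M : Matrix ι ι R) (d : ι → R) :
    (M + diagonal d).det =
      ∑ S : Finset ι, (M.submatrix (Subtype.val : S → ι) Subtype.val).det * ∏ i ∈ Sᶜ, d i := by
  simp_rw [← det_piecewise_diagonal]
  exact (detRowAlternating : (ι → R) [⋀^ι]→ₗ[R] R).map_add_univ M (diagonal d)

/-- The tangent-plane inequality for `log det` at the identity matrix. -/
lemma log_det_le_trace_sub_card {M : Matrix ι ι ℝ} (hM : M.PosDef) :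
    Real.log M.det ≤ M.trace - Fintype.card ι := by
  have hdet := hM.1.det_eq_prod_eigenvalues
  have htr := hM.1.trace_eq_sum_eigenvalues
  simp only [RCLike.ofReal_real_eq_id, id] at hdet htr
  rw [hdet, htr, Real.log_prod fun i _ => (hM.eigenvalues_pos i).ne']
  calc ∑ i, Real.log (hM.1.eigenvalues i) ≤ ∑ i, (hM.1.eigenvalues i - 1) :=
        Finset.sum_le_sum fun i _ => Real.log_le_sub_one_of_pos (hM.eigenvalues_pos i)
    _ = _ := by simp [Finset.sum_sub_distrib]

/-- The tangent-plane inequality for `log det` at a positive definite `Z`, whose gradient there is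
`Z⁻¹`. It follows from the case `Z = 1` by congruence with a factor `B` of `Z = Bᴴ B`. -/
lemma log_det_le_log_det_add_trace {X Z : Matrix ι ι ℝ} (hX : X.PosDef) (hZ : Z.PosDef) :
    Real.log X.det ≤ Real.log Z.det + (Z⁻¹ * X).trace - Fintype.card ι := by
  obtain ⟨B, hB⟩ : ∃ B : Matrix ι ι ℝ, Z = Bᴴ * B := by
    open scoped MatrixOrder in
    exact CStarAlgebra.nonneg_iff_eq_star_mul_self.mp hZ.posSemidef.nonneg
  have hZdet : Z.det = B.det * B.det := by rw [hB, det_mul, det_conjTranspose]; simp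
  have hBdet : B.det ≠ 0 := by
    intro h
    have := hZ.det_pos
    simp [hZdet, h] at this
  have hBu : IsUnit B := (isUnit_iff_isUnit_det B).2 (isUnit_iff_ne_zero.2 hBdet)
  have hM : (B⁻¹ᴴ * X * B⁻¹).PosDef := by
    refine hX.conjTranspose_mul_mul_same ?_
    exact mulVec_injective_iff_isUnit.2 (by simpa using hBu)
  have h := log_det_le_trace_sub_card hM
  have htr : (B⁻¹ᴴ * X * B⁻¹).trace = (Z⁻¹ * X).trace := by
    rw [trace_mul_comm, hB, Matrix.mul_inv_rev, ← mul_assoc, conjTranspose_nonsing_inv]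
  have hdet : (B⁻¹ᴴ * X * B⁻¹).det = X.det / Z.det := by
    simp only [det_mul, det_conjTranspose, det_nonsing_inv, hZdet, Ring.inverse_eq_inv',
      star_trivial]
    field_simp
  rw [htr, hdet, Real.log_div hX.det_pos.ne' hZ.det_pos.ne'] at h
  linarith

/-- `log det` is concave on the positive definite matrices. -/
lemma log_det_concave {X Y : Matrix ι ι ℝ} (hX : X.PosDef) (hY : Y.PosDef) {a b : ℝ}
    (ha : 0 ≤ a) (hb : 0 ≤ b) (hab : a + b = 1) :
    a * Real.log X.det + b * Real.log Y.det ≤ Real.log (a • X + b • Y).det := by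
  -- Average the tangent-plane inequalities at `Z = aX + bY`; the trace terms combine to
  -- `tr (Z⁻¹ Z)`, the order of the matrices.
  have hZ := posDef_combination hX hY ha hb hab
  set Z := a • X + b • Y with hZdef
  have h1 := mul_le_mul_of_nonneg_left (log_det_le_log_det_add_trace hX hZ) ha
  have h2 := mul_le_mul_of_nonneg_left (log_det_le_log_det_add_trace hY hZ) hb
  have htr : a * (Z⁻¹ * X).trace + b * (Z⁻¹ * Y).trace = Fintype.card ι := by
    have h : (Z⁻¹ * Z).trace = a * (Z⁻¹ * X).trace + b * (Z⁻¹ * Y).trace := by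
      conv_lhs => rw [hZdef, mul_add, mul_smul_comm, mul_smul_comm, trace_add, trace_smul,
        trace_smul, smul_eq_mul, smul_eq_mul]
    rw [← h, nonsing_inv_mul _ (isUnit_iff_ne_zero.2 hZ.det_pos.ne'), trace_one]
  have hb' : b = 1 - a := by linarith
  subst hb'
  linarith

end General

/-! ### Posynomials -/

/-- A posynomial `∑ c_k exp (ℓ_k)` with nonnegative coefficients is log-convex in its exponents. -/
lemma log_sum_exp_convex {κ : Type*} (K : Finset κ) (c p q : κ → ℝ) (hc : ∀ k ∈ K, 0 ≤ c k)
    (hp : 0 < ∑ k ∈ K, c k * Real.exp (p k)) (hq : 0 < ∑ k ∈ K, c k * Real.exp (q k))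
    {a b : ℝ} (ha : 0 ≤ a) (hb : 0 ≤ b) (hab : a + b = 1)
    (hz : 0 < ∑ k ∈ K, c k * Real.exp (a * p k + b * q k)) :
    Real.log (∑ k ∈ K, c k * Real.exp (a * p k + b * q k)) ≤
      a * Real.log (∑ k ∈ K, c k * Real.exp (p k)) +
        b * Real.log (∑ k ∈ K, c k * Real.exp (q k)) := by
  set P := ∑ k ∈ K, c k * Real.exp (p k) with hP
  set Q := ∑ k ∈ K, c k * Real.exp (q k) with hQ
  rw [Real.log_le_iff_le_exp hz]
  -- Convexity of `exp` applied to the exponents normalised by `log P` and `log Q`.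
  have key : ∀ k ∈ K, c k * Real.exp (a * p k + b * q k) ≤
      Real.exp (a * Real.log P + b * Real.log Q) *
        (a * (c k * Real.exp (p k) / P) + b * (c k * Real.exp (q k) / Q)) := by
    intro k hk
    have h := convexOn_exp.2 (Set.mem_univ (p k - Real.log P)) (Set.mem_univ (q k - Real.log Q))
      ha hb hab
    simp only [smul_eq_mul, Real.exp_sub, Real.exp_log hp, Real.exp_log hq] at h
    have he : Real.exp (a * p k + b * q k) = Real.exp (a * Real.log P + b * Real.log Q) *
        Real.exp (a * (p k - Real.log P) + b * (q k - Real.log Q)) := by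
      rw [← Real.exp_add]; congr 1; ring
    rw [he]
    calc _ = Real.exp (a * Real.log P + b * Real.log Q) *
          (c k * Real.exp (a * (p k - Real.log P) + b * (q k - Real.log Q))) := by ring
      _ ≤ Real.exp (a * Real.log P + b * Real.log Q) *
          (c k * (a * (Real.exp (p k) / P) + b * (Real.exp (q k) / Q))) := by
        have := hc k hk
        gcongr
      _ = _ := by ring
  refine (Finset.sum_le_sum key).trans_eq ?_
  rw [← Finset.mul_sum, Finset.sum_add_distrib, ← Finset.mul_sum, ← Finset.mul_sum,
    ← Finset.sum_div, ← Finset.sum_div, ← hP, ← hQ, div_self hp.ne', div_self hq.ne']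
  simp [hab]

/-! ### The scaled matrix -/

variable {n m : ℕ} {C : Matrix (Fin n) (Fin n) ℝ}

lemma transpose_eq_self (hC : C.PosSemidef) : Cᵀ = C := by
  rw [← conjTranspose_eq_transpose_of_trivial]
  exact hC.1

lemma linxMatrix_isHermitian (hC : C.PosSemidef) (Υ x : Fin n → ℝ) :
    (linxMatrix C Υ x).IsHermitian := by
  have h := transpose_eq_self hC
  simp [Matrix.IsHermitian, linxMatrix, transpose_mul, h, mul_assoc]

lemma linxMatrix_posSemidef (hC : C.PosSemidef) (Υ : Fin n → ℝ) {x : Fin n → ℝ}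
    (hx : ∀ i, 0 ≤ x i ∧ x i ≤ 1) : (linxMatrix C Υ x).PosSemidef := by
  have h := transpose_eq_self hC
  refine .add ?_ (.diagonal fun i => sub_nonneg.2 (hx i).2)
  have := (PosSemidef.diagonal (d := x) fun i => (hx i).1).conjTranspose_mul_mul_same
    (C * diagonal Υ)
  simpa [transpose_mul, h, mul_assoc] using this

lemma mem_linxDom_iff_det_pos (hC : C.PosSemidef) (Υ : Fin n → ℝ) {x : Fin n → ℝ}
    (hx : ∀ i, 0 ≤ x i ∧ x i ≤ 1) : x ∈ linxDom C Υ ↔ 0 < (linxMatrix C Υ x).det := by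
  have h := linxMatrix_posSemidef hC Υ hx
  rw [linxDom, Set.mem_ofPred_eq, h.posDef_iff_det_ne_zero]
  exact ⟨fun hne => lt_of_le_of_ne h.det_nonneg hne.symm, ne_of_gt⟩

lemma linxMatrix_combination (Υ x y : Fin n → ℝ) {a b : ℝ} (hab : a + b = 1) :
    linxMatrix C Υ (a • x + b • y) = a • linxMatrix C Υ x + b • linxMatrix C Υ y := by
  have h1 : diagonal (a • x + b • y) = a • diagonal x + b • diagonal y := by
    ext i j; by_cases hij : i = j <;> simp [hij]
  have h2 : diagonal (fun i => 1 - (a • x + b • y) i) =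
      a • diagonal (fun i => 1 - x i) + b • diagonal (fun i => 1 - y i) := by
    ext i j
    by_cases hij : i = j
    · subst hij
      simp
      linear_combination -hab
    · simp [hij]
  rw [linxMatrix, h1, h2]
  simp only [linxMatrix, mul_add, add_mul, smul_add, Matrix.mul_smul, Matrix.smul_mul]
  abel

lemma continuous_linxMatrix :
    Continuous fun p : (Fin n → ℝ) × (Fin n → ℝ) => linxMatrix C p.2 p.1 := by
  unfold linxMatrix
  fun_prop

lemma contDiff_det_linxMatrix :
    ContDiff ℝ 1 fun p : (Fin n → ℝ) × (Fin n → ℝ) => (linxMatrix C p.2 p.1).det := by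
  have h : ∀ i j, ContDiff ℝ 1 fun p : (Fin n → ℝ) × (Fin n → ℝ) => linxMatrix C p.2 p.1 i j := by
    intro i j
    simp only [linxMatrix, Matrix.add_apply, mul_diagonal, mul_apply (N := C),
      diagonal_apply]
    simp only [ite_mul, zero_mul, Finset.sum_ite_eq, Finset.mem_univ, if_true]
    split_ifs <;> fun_prop
  simp only [det_apply]
  fun_prop

/-! ### Validity of the bound -/

/-- At a `0/1` point the matrix factors as `Gᵀ G`, where `G` consists of the rows of `C Diag(Υ)` on
the support and of the rows of the identity elsewhere. -/
lemma det_linxMatrix_of_binary (hC : C.PosSemidef) (Υ : Fin n → ℝ) {x : Fin n → ℝ}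
    (hx : ∀ i, x i = 0 ∨ x i = 1) :
    (linxMatrix C Υ x).det = ((principal C (supp x)).det * ∏ i, Υ i ^ x i) ^ 2 := by
  have hCt := transpose_eq_self hC
  set S := supp x with hS
  have hmem : ∀ i, i ∈ S ↔ x i = 1 := by
    intro i
    rcases hx i with h | h <;> simp [hS, supp, h]
  set G : Matrix (Fin n) (Fin n) ℝ :=
    of (S.piecewise (C * diagonal Υ) (diagonal fun _ => 1)) with hG
  have hGe : G = diagonal x * C * diagonal Υ + diagonal (fun i => 1 - x i) := by
    ext i j
    rcases hx i with h | h
    · have : i ∉ S := by simp [hmem, h]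
      by_cases hij : i = j
      · subst hij; simp [hG, Finset.piecewise, this, h, mul_assoc, diagonal_mul]
      · simp [hG, Finset.piecewise, this, h, mul_assoc, diagonal_mul, hij]
    · have : i ∈ S := by simp [hmem, h]
      by_cases hij : i = j
      · subst hij; simp [hG, Finset.piecewise, this, h, mul_assoc, diagonal_mul]
      · simp [hG, Finset.piecewise, this, h, mul_assoc, diagonal_mul, hij]
  have hF : linxMatrix C Υ x = Gᵀ * G := by
    have h1 : diagonal x * diagonal x = diagonal x := by
      rw [diagonal_mul_diagonal]; congr 1; funext i; rcases hx i with h | h <;> simp [h]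
    have h2 : diagonal x * diagonal (fun i => 1 - x i) = 0 := by
      rw [diagonal_mul_diagonal, ← diagonal_zero]
      congr 1; funext i; rcases hx i with h | h <;> simp [h]
    have h3 : diagonal (fun i => 1 - x i) * diagonal x = 0 := by
      rw [diagonal_mul_diagonal, ← diagonal_zero]
      congr 1; funext i; rcases hx i with h | h <;> simp [h]
    have h4 : diagonal (fun i => 1 - x i) * diagonal (fun i => 1 - x i) =
        diagonal (fun i => 1 - x i) := by
      rw [diagonal_mul_diagonal]; congr 1; funext i; rcases hx i with h | h <;> simp [h]
    rw [hGe]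
    simp only [linxMatrix, transpose_add, transpose_mul, diagonal_transpose, hCt, mul_add, add_mul]
    have e1 : diagonal Υ * (C * diagonal x) * (diagonal x * C * diagonal Υ) =
        diagonal Υ * C * diagonal x * C * diagonal Υ := by
      
      simp only [mul_assoc]
      rw [← mul_assoc (diagonal x) (diagonal x), h1]
    have e2 : diagonal (fun i => 1 - x i) * (diagonal x * C * diagonal Υ) = 0 := by
      rw [← mul_assoc, ← mul_assoc, h3]; simp
    have e3 : diagonal Υ * (C * diagonal x) * diagonal (fun i => 1 - x i) = 0 := by
      rw [mul_assoc, mul_assoc, h2]; simp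
    rw [e1, e2, e3, h4]
    simp
  have hdet : G.det = (principal C S).det * ∏ i, Υ i ^ x i := by
    rw [hG, det_piecewise_diagonal]
    have h5 : (C * diagonal Υ).submatrix (Subtype.val : S → Fin n) Subtype.val =
        principal C S * diagonal (fun i : S => Υ i) := by
      ext i j; simp [principal]
    have h6 : ∏ i, Υ i ^ x i = ∏ i ∈ S, Υ i := by
      rw [← Finset.prod_subset (Finset.subset_univ S)]
      · exact Finset.prod_congr rfl fun i hi => by simp [(hmem i).1 hi]
      · intro i _ hi
        rcases hx i with h | h
        · simp [h]
        · exact absurd ((hmem i).2 h) hi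
    rw [h5, det_mul, det_diagonal, h6, Finset.prod_coe_sort S Υ]
    simp
  rw [hF, det_mul, det_transpose, hdet]
  ring

lemma cmespObj_le_linxObj (hC : C.PosSemidef) {Υ : Fin n → ℝ} (hΥ : ∀ i, 0 < Υ i)
    {x : Fin n → ℝ} (hx : ∀ i, x i = 0 ∨ x i = 1) : cmespObj C x ≤ linxObj C Υ x := by
  unfold cmespObj ldet
  split_ifs with hpos
  · have hx' : ∀ i, 0 ≤ x i ∧ x i ≤ 1 := fun i => by rcases hx i with h | h <;> simp [h]
    have hprod : 0 < ∏ i, Υ i ^ x i := Finset.prod_pos fun i _ => Real.rpow_pos_of_pos (hΥ i) _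
    have hdet := det_linxMatrix_of_binary hC Υ hx
    have hdom : x ∈ linxDom C Υ := by
      rw [mem_linxDom_iff_det_pos hC Υ hx', hdet]
      positivity
    rw [linxObj, if_pos hdom, EReal.coe_le_coe_iff, fLinx, hdet, Real.log_pow,
      Real.log_mul hpos.ne' hprod.ne', Real.log_prod fun i _ => (Real.rpow_pos_of_pos (hΥ i) _).ne']
    simp only [Real.log_rpow (hΥ _)]
    push_cast
    linarith
  · exact bot_le

/-! ### Convexity in the logarithm of the scaling vector -/

/-- The coefficients of `det F(x; Υ)` as a polynomial in the squares of the scaling factors. -/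
def linxCoeff (C : Matrix (Fin n) (Fin n) ℝ) (x : Fin n → ℝ) (S : Finset (Fin n)) : ℝ :=
  (principal (C * diagonal x * C) S).det * ∏ i ∈ Sᶜ, (1 - x i)

lemma linxCoeff_nonneg (hC : C.PosSemidef) {x : Fin n → ℝ} (hx : ∀ i, 0 ≤ x i ∧ x i ≤ 1)
    (S : Finset (Fin n)) : 0 ≤ linxCoeff C x S := by
  have h := transpose_eq_self hC
  have hM : (C * diagonal x * C).PosSemidef := by
    simpa [h] using
      (PosSemidef.diagonal (d := x) fun i => (hx i).1).conjTranspose_mul_mul_same C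
  exact mul_nonneg (hM.submatrix _).det_nonneg
    (Finset.prod_nonneg fun i _ => sub_nonneg.2 (hx i).2)

lemma det_linxMatrix_eq_sum (x Υ : Fin n → ℝ) :
    (linxMatrix C Υ x).det = ∑ S : Finset (Fin n), linxCoeff C x S * (∏ i ∈ S, Υ i) ^ 2 := by
  rw [linxMatrix, det_add_diagonal]
  refine Finset.sum_congr rfl fun S _ => ?_
  have h : (diagonal Υ * C * diagonal x * C * diagonal Υ).submatrix
      (Subtype.val : S → Fin n) Subtype.val =
      diagonal (fun i : S => Υ i) * principal (C * diagonal x * C) S *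
        diagonal (fun i : S => Υ i) := by
    have : diagonal Υ * C * diagonal x * C * diagonal Υ =
        diagonal Υ * (C * diagonal x * C) * diagonal Υ := by simp only [mul_assoc]
    rw [this]
    ext i j
    rw [submatrix_apply, mul_diagonal, diagonal_mul, mul_diagonal, diagonal_mul]
    rfl
  rw [h, det_mul, det_mul, det_diagonal, Finset.prod_coe_sort S Υ, linxCoeff]
  ring

/-- For `x` in the unit box, membership in the domain does not depend on the scaling: it says that
some coefficient of the determinant polynomial is positive. -/
lemma mem_linxDom_of_mem_linxDom (hC : C.PosSemidef) {x Υ Υ' : Fin n → ℝ}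
    (hx : ∀ i, 0 ≤ x i ∧ x i ≤ 1) (hΥ' : ∀ i, 0 < Υ' i) (h : x ∈ linxDom C Υ) :
    x ∈ linxDom C Υ' := by
  rw [mem_linxDom_iff_det_pos hC _ hx, det_linxMatrix_eq_sum] at h ⊢
  obtain ⟨S, -, hS⟩ := Finset.exists_ne_zero_of_sum_ne_zero h.ne'
  have hc : 0 < linxCoeff C x S :=
    lt_of_le_of_ne (linxCoeff_nonneg hC hx S) (left_ne_zero_of_mul hS).symm
  refine Finset.sum_pos' (fun T _ => mul_nonneg (linxCoeff_nonneg hC hx T) (sq_nonneg _))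
    ⟨S, Finset.mem_univ S, mul_pos hc (pow_pos (Finset.prod_pos fun i _ => hΥ' i) 2)⟩

lemma det_linxMatrix_exp (x u : Fin n → ℝ) :
    (linxMatrix C (fun i => Real.exp (u i)) x).det =
      ∑ S : Finset (Fin n), linxCoeff C x S * Real.exp (2 * ∑ i ∈ S, u i) := by
  rw [det_linxMatrix_eq_sum]
  refine Finset.sum_congr rfl fun S _ => ?_
  rw [← Real.exp_sum, ← Real.exp_nat_mul]
  norm_num

lemma fLinx_exp_convex (hC : C.PosSemidef) {x Υ : Fin n → ℝ} (hx : ∀ i, 0 ≤ x i ∧ x i ≤ 1)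
    (h : x ∈ linxDom C Υ) :
    ConvexOn ℝ Set.univ (fun u : Fin n → ℝ => fLinx C x (fun i => Real.exp (u i))) := by
  refine ⟨convex_univ, fun u _ v _ a b ha hb hab => ?_⟩
  have hpos : ∀ w : Fin n → ℝ,
      0 < ∑ S : Finset (Fin n), linxCoeff C x S * Real.exp (2 * ∑ i ∈ S, w i) := by
    intro w
    rw [← det_linxMatrix_exp, ← mem_linxDom_iff_det_pos hC _ hx]
    exact mem_linxDom_of_mem_linxDom hC hx (fun i => Real.exp_pos _) h
  have hlin : ∀ S : Finset (Fin n), 2 * ∑ i ∈ S, (a • u + b • v) i =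
      a * (2 * ∑ i ∈ S, u i) + b * (2 * ∑ i ∈ S, v i) := by
    intro S
    simp only [Pi.add_apply, Pi.smul_apply, smul_eq_mul, Finset.sum_add_distrib, ← Finset.mul_sum]
    ring
  have hx1 : ∑ i, x i * (a • u + b • v) i = a * ∑ i, x i * u i + b * ∑ i, x i * v i := by
    simp only [Finset.mul_sum, ← Finset.sum_add_distrib]
    exact Finset.sum_congr rfl fun i _ => by simp; ring
  have hz := hpos (a • u + b • v)
  simp_rw [hlin] at hz
  have key := log_sum_exp_convex Finset.univ (linxCoeff C x) (fun S => 2 * ∑ i ∈ S, u i)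
    (fun S => 2 * ∑ i ∈ S, v i) (fun S _ => linxCoeff_nonneg hC hx S) (hpos u) (hpos v)
    ha hb hab hz
  simp only [fLinx, det_linxMatrix_exp, Real.log_exp, hlin, hx1, smul_eq_mul]
  linarith

/-! ### Concavity in `x` -/

lemma fLinx_concave (C : Matrix (Fin n) (Fin n) ℝ) (Υ : Fin n → ℝ) :
    ConcaveOn ℝ (linxDom C Υ) (fun x => fLinx C x Υ) := by
  constructor
  · intro x hx y hy a b ha hb hab
    rw [linxDom, Set.mem_ofPred_eq, linxMatrix_combination Υ x y hab]
    exact posDef_combination hx hy ha hb hab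
  · intro x hx y hy a b ha hb hab
    have key := log_det_concave hx hy ha hb hab
    have hlin : ∑ i, (a • x + b • y) i * Real.log (Υ i) =
        a * ∑ i, x i * Real.log (Υ i) + b * ∑ i, y i * Real.log (Υ i) := by
      simp only [Finset.mul_sum, ← Finset.sum_add_distrib]
      exact Finset.sum_congr rfl fun i _ => by simp; ring
    simp only [fLinx, linxMatrix_combination Υ x y hab, hlin, smul_eq_mul]
    linarith

/-! ### Smoothness -/

lemma isOpen_joint_domain (hC : C.PosSemidef) :
    IsOpen {p : (Fin n → ℝ) × (Fin n → ℝ) | (∀ i, 0 < p.2 i) ∧ p.1 ∈ linxDom C p.2} := by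
  have h : IsOpen (⋂ i : Fin n, {p : (Fin n → ℝ) × (Fin n → ℝ) | 0 < p.2 i}) :=
    isOpen_iInter_of_finite fun i => isOpen_lt continuous_const (by fun_prop)
  convert h.inter (isOpen_setOf_posDef (continuous_linxMatrix (C := C))
    fun p => linxMatrix_isHermitian hC p.2 p.1) using 1
  ext p
  simp [linxDom]

lemma contDiffOn_fLinx (C : Matrix (Fin n) (Fin n) ℝ) :
    ContDiffOn ℝ 1 (fun p : (Fin n → ℝ) × (Fin n → ℝ) => fLinx C p.1 p.2)
      {p : (Fin n → ℝ) × (Fin n → ℝ) | (∀ i, 0 < p.2 i) ∧ p.1 ∈ linxDom C p.2} := by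
  unfold fLinx
  refine .sub (.mul contDiffOn_const (contDiff_det_linxMatrix.contDiffOn.log
    fun p hp => (PosDef.det_pos hp.2).ne')) (.sum fun i _ => .mul ?_ (.log ?_ ?_))
  · exact ContDiff.contDiffOn (by fun_prop)
  · exact ContDiff.contDiffOn (by fun_prop)
  · exact fun p hp => (hp.1 i).ne'

/-! ### Attainment and convexity of the optimal values -/

lemma cmespFeasible_finite (s : ℕ) (A : Matrix (Fin m) (Fin n) ℝ) (b : Fin m → ℝ) :
    (cmespFeasible s A b).Finite := by
  refine (Set.Finite.pi (t := fun _ : Fin n => ({0, 1} : Set ℝ)) fun _ => Set.toFinite _).subset ?_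
  intro x hx
  simpa using hx.2.1

lemma isGreatest_zCmesp (s : ℕ) (A : Matrix (Fin m) (Fin n) ℝ) (b : Fin m → ℝ)
    (h : (cmespFeasible s A b).Nonempty) :
    IsGreatest (cmespObj C '' cmespFeasible s A b) (zCmesp C s A b) :=
  ⟨(h.image _).csSup_mem ((cmespFeasible_finite s A b).image _), fun _ hy => le_sSup hy⟩

lemma isCompact_linxFeasible (s : ℕ) (A : Matrix (Fin m) (Fin n) ℝ) (b : Fin m → ℝ) :
    IsCompact (linxFeasible s A b) := by
  refine (isCompact_Icc (a := (0 : Fin n → ℝ)) (b := 1)).of_isClosed_subset ?_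
    fun x hx => ⟨fun i => (hx.2.1 i).1, fun i => (hx.2.1 i).2⟩
  have h₁ : IsClosed {x : Fin n → ℝ | ∑ i, x i = s} :=
    isClosed_eq (by fun_prop) continuous_const
  have h₂ : IsClosed (Set.Icc (0 : Fin n → ℝ) 1) := isClosed_Icc
  have h₃ : IsClosed {x : Fin n → ℝ | A *ᵥ x ≤ b} := isClosed_le (by fun_prop) continuous_const
  convert h₁.inter (h₂.inter h₃) using 1
  ext x
  simp [linxFeasible, Pi.le_def, forall_and]

/-- In general the objective has no continuous real-valued extension to the whole feasible set,
but `exp (2 f) = det F · exp (-2 ∑ xᵢ log γᵢ)` has one, vanishing off the domain. A maximiser of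
the latter over the compact feasible set is a maximiser of `f`. -/
lemma isGreatest_zLinx (hC : C.PosSemidef) (s : ℕ) (A : Matrix (Fin m) (Fin n) ℝ)
    (b : Fin m → ℝ) (Υ : Fin n → ℝ) (h : (linxFeasible s A b).Nonempty) :
    IsGreatest (linxObj C Υ '' linxFeasible s A b) (zLinx C s A b Υ) := by
  refine ⟨?_, fun _ hy => le_sSup hy⟩
  set g : (Fin n → ℝ) → ℝ := fun x =>
    (linxMatrix C Υ x).det * Real.exp (-2 * ∑ i, x i * Real.log (Υ i)) with hg
  have hgc : Continuous g := by
    simp only [hg, linxMatrix]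
    fun_prop
  obtain ⟨x₀, hx₀, hmax⟩ := (isCompact_linxFeasible s A b).exists_isMaxOn h hgc.continuousOn
  have hlog : ∀ x ∈ linxFeasible s A b, x ∈ linxDom C Υ → fLinx C x Υ = 1 / 2 * Real.log (g x) := by
    intro x hx hxd
    have hd := (mem_linxDom_iff_det_pos hC Υ hx.2.1).1 hxd
    simp only [hg, fLinx]
    rw [Real.log_mul hd.ne' (Real.exp_pos _).ne', Real.log_exp]
    ring
  refine ⟨x₀, hx₀, le_antisymm (le_sSup ⟨x₀, hx₀, rfl⟩) (sSup_le ?_)⟩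
  rintro _ ⟨x, hx, rfl⟩
  by_cases hxd : x ∈ linxDom C Υ
  · have hgx : 0 < g x :=
      mul_pos ((mem_linxDom_iff_det_pos hC Υ hx.2.1).1 hxd) (Real.exp_pos _)
    have hle : g x ≤ g x₀ := hmax hx
    have hx₀d : x₀ ∈ linxDom C Υ := (mem_linxDom_iff_det_pos hC Υ hx₀.2.1).2
      (pos_of_mul_pos_left (hgx.trans_le hle) (Real.exp_pos _).le)
    rw [linxObj, linxObj, if_pos hxd, if_pos hx₀d, EReal.coe_le_coe_iff, hlog x hx hxd,
      hlog x₀ hx₀ hx₀d]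
    have := Real.log_le_log hgx hle
    linarith
  · rw [linxObj, if_neg hxd]
    exact bot_le

lemma fLinx_le_zLinx {s : ℕ} {A : Matrix (Fin m) (Fin n) ℝ} {b : Fin m → ℝ} {Υ x : Fin n → ℝ}
    (hx : x ∈ linxFeasible s A b) (hd : x ∈ linxDom C Υ) :
    (fLinx C x Υ : EReal) ≤ zLinx C s A b Υ :=
  le_sSup ⟨x, hx, by rw [linxObj, if_pos hd]⟩

lemma zLinx_exp_convex (hC : C.PosSemidef) (s : ℕ) (A : Matrix (Fin m) (Fin n) ℝ)
    (b : Fin m → ℝ) (u v : Fin n → ℝ) {t r : ℝ} (ht : 0 ≤ t) (hr : 0 ≤ r) (htr : t + r = 1) :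
    zLinx C s A b (fun i => Real.exp (t * u i + r * v i)) ≤
      (t : EReal) * zLinx C s A b (fun i => Real.exp (u i)) +
      (r : EReal) * zLinx C s A b (fun i => Real.exp (v i)) := by
  refine sSup_le ?_
  rintro _ ⟨x, hx, rfl⟩
  unfold linxObj
  split_ifs with hd
  · have hdom : ∀ w : Fin n → ℝ, x ∈ linxDom C (fun i => Real.exp (w i)) := fun w =>
      mem_linxDom_of_mem_linxDom hC hx.2.1 (fun i => Real.exp_pos _) hd
    have hconv := (fLinx_exp_convex hC hx.2.1 hd).2 (Set.mem_univ u) (Set.mem_univ v) ht hr htr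
    calc (fLinx C x (fun i => Real.exp (t * u i + r * v i)) : EReal)
        ≤ ((t * fLinx C x (fun i => Real.exp (u i)) +
            r * fLinx C x (fun i => Real.exp (v i)) : ℝ) : EReal) :=
          EReal.coe_le_coe_iff.2 hconv
      _ = (t : EReal) * (fLinx C x (fun i => Real.exp (u i)) : ℝ) +
            (r : EReal) * (fLinx C x (fun i => Real.exp (v i)) : ℝ) := by
          push_cast; rfl
      _ ≤ _ := by
          gcongr
          · exact fLinx_le_zLinx hx (hdom u)
          · exact fLinx_le_zLinx hx (hdom v)
  · exact bot_le

end Linx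

theorem theorem2 (n m s : ℕ) (hn : 1 < n) (hs : 0 < s) (hsn : s < n)
    (C : Matrix (Fin n) (Fin n) ℝ) (hC : C.PosSemidef) (hr : s ≤ C.rank)
    (A : Matrix (Fin m) (Fin n) ℝ) (b : Fin m → ℝ) :
    -- the two optimal values are maxima whenever the respective problem is feasible
    ((Linx.cmespFeasible s A b).Nonempty →
      IsGreatest (Linx.cmespObj C '' Linx.cmespFeasible s A b) (Linx.zCmesp C s A b)) ∧
    (∀ Υ : Fin n → ℝ, (∀ i, 0 < Υ i) → (Linx.linxFeasible s A b).Nonempty →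
      IsGreatest (Linx.linxObj C Υ '' Linx.linxFeasible s A b) (Linx.zLinx C s A b Υ)) ∧
    -- (i) the bound is valid
    (∀ Υ : Fin n → ℝ, (∀ i, 0 < Υ i) →
      Linx.zCmesp C s A b ≤ Linx.zLinx C s A b Υ) ∧
    -- (ii) concavity in `x`, and continuous differentiability in `(x, Υ)`
    (∀ Υ : Fin n → ℝ, (∀ i, 0 < Υ i) →
      ConcaveOn ℝ (Linx.linxDom C Υ) (fun x => Linx.fLinx C x Υ)) ∧
    (IsOpen {p : (Fin n → ℝ) × (Fin n → ℝ) |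
        (∀ i, 0 < p.2 i) ∧ p.1 ∈ Linx.linxDom C p.2} ∧
      ContDiffOn ℝ 1 (fun p : (Fin n → ℝ) × (Fin n → ℝ) => Linx.fLinx C p.1 p.2)
        {p : (Fin n → ℝ) × (Fin n → ℝ) |
          (∀ i, 0 < p.2 i) ∧ p.1 ∈ Linx.linxDom C p.2}) ∧
    -- (iii) convexity in `log Υ` of `f_linx(x; ·)` and of `z_linx`
    (∀ Υ : Fin n → ℝ, (∀ i, 0 < Υ i) → ∀ x ∈ Linx.linxDom C Υ, (∀ i, 0 ≤ x i ∧ x i ≤ 1) →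
      (∀ Υ' : Fin n → ℝ, (∀ i, 0 < Υ' i) → x ∈ Linx.linxDom C Υ') ∧
      ConvexOn ℝ Set.univ
        (fun u : Fin n → ℝ => Linx.fLinx C x (fun i => Real.exp (u i)))) ∧
    (∀ (u v : Fin n → ℝ) (t r : ℝ), 0 ≤ t → 0 ≤ r → t + r = 1 →
      Linx.zLinx C s A b (fun i => Real.exp (t * u i + r * v i)) ≤
        (t : EReal) * Linx.zLinx C s A b (fun i => Real.exp (u i)) +
        (r : EReal) * Linx.zLinx C s A b (fun i => Real.exp (v i))) := by
  refine ⟨Linx.isGreatest_zCmesp s A b, fun Υ _ => Linx.isGreatest_zLinx hC s A b Υ, ?_,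
    fun Υ _ => Linx.fLinx_concave C Υ, ⟨Linx.isOpen_joint_domain hC, Linx.contDiffOn_fLinx C⟩,
    fun Υ _ x hd hx => ⟨fun Υ' hΥ' => Linx.mem_linxDom_of_mem_linxDom hC hx hΥ' hd,
      Linx.fLinx_exp_convex hC hx hd⟩,
    fun u v t r ht hr htr => Linx.zLinx_exp_convex hC s A b u v ht hr htr⟩
  intro Υ hΥ
  refine sSup_le ?_
  rintro _ ⟨x, hx, rfl⟩
  refine (Linx.cmespObj_le_linxObj hC hΥ hx.2.1).trans (le_sSup ⟨x, ⟨hx.1, ?_, hx.2.2⟩, rfl⟩)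
  intro i
  rcases hx.2.1 i with h | h <;> simp [h]
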